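/- All graphs are finite and simple. A graph $G=(V,E)$ is a \emph{weak unit interval graph} if for every labeling of its edges as ``near'' or ``far'' one can assign to each vertex $v$ a closed interval of unit length on the real line such that, for every edge $uv\in E$, the intervals of $u$ and $v$ intersect if and only if $uv$ is labeled near (nothing is required of nonadjacent vertices). The \emph{maximum average degree} $\mathrm{mad}(G)$ is the largest average vertex degree of a nonempty subgraph of $G$. A graph is \emph{planar} if it can be drawn in the plane with its vertices as distinct points and its edges as simple (polygonal) arcs between their ends, so that an arc contains no vertex other than its ends and two different arcs meet only in common ends. \textbf{Theorem.} Let $G=(V,E)$ be a planar graph. (1) If $\mathrm{mad}(G)\ge \frac{11}{2}$, then $G$ is not a weak unit interval graph. (2) If $G$ is a weak unit interval graph and $|V|\ge 4$, then $|E|\le \frac{11}{4}|V|-6$. -/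

import Mathlib

namespace WeakUnitInterval

/-- The label of an edge. -/
inductive Label where
  | near
  | far

/-- The closed interval of unit length centred at `c`. -/
def centredInterval (c : ℝ) : Set ℝ := Set.Icc (c - 1 / 2) (c + 1 / 2)

/-- `I` (a placement of the centres of unit intervals) is a weak unit interval representation of
`G` with respect to the edge-labeling `l`: for every edge `uv`, the intervals of `u` and `v`
intersect if and only if `uv` is labeled near. Nothing is required of nonadjacent vertices. -/
def IsRepresentation {V : Type*} (G : SimpleGraph V) (l : G.EdgeLabeling Label) (I : V → ℝ) :
    Prop :=
  ∀ (u v : V) (h : G.Adj u v),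
    (centredInterval (I u) ∩ centredInterval (I v)).Nonempty ↔ l.get u v h = Label.near

/-- `G` is a weak unit interval graph: every near/far labeling of its edges has a weak unit
interval representation. -/
def IsWeakUnitIntervalGraph {V : Type*} (G : SimpleGraph V) : Prop :=
  ∀ l : G.EdgeLabeling Label, ∃ I : V → ℝ, IsRepresentation G l I

open Classical in
/-- The average vertex degree of a subgraph `H` of a finite graph. -/
noncomputable def averageDegree {V : Type*} [Fintype V] {G : SimpleGraph V} (H : G.Subgraph) : ℝ :=
  (∑ v with v ∈ H.verts, (H.degree v : ℝ)) / (H.verts.ncard : ℝ)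

/-- The maximum average degree: the largest average degree of a nonempty subgraph. The supremum
is over a finite set, hence a maximum when `V` is nonempty (and it is `0` when `V` is empty). -/
noncomputable def mad {V : Type*} [Fintype V] (G : SimpleGraph V) : ℝ :=
  sSup {d : ℝ | ∃ H : G.Subgraph, H.verts.Nonempty ∧ averageDegree H = d}

/-- `A` is a (simple) polygonal arc in the plane from `p` to `q`: it is the union of the finitely
many nondegenerate segments of a chain `p = x 0, x 1, …, x (n + 1) = q`, where consecutive segments
meet only in their common endpoint and other pairs of segments are disjoint. -/
def IsPolygonalArc (p q : ℝ × ℝ) (A : Set (ℝ × ℝ)) : Prop :=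
  ∃ (n : ℕ) (x : ℕ → ℝ × ℝ), x 0 = p ∧ x (n + 1) = q ∧
    (∀ i ≤ n, x i ≠ x (i + 1)) ∧
    (∀ i < n, segment ℝ (x i) (x (i + 1)) ∩ segment ℝ (x (i + 1)) (x (i + 2)) = {x (i + 1)}) ∧
    (∀ i j, i + 1 < j → j ≤ n →
      Disjoint (segment ℝ (x i) (x (i + 1))) (segment ℝ (x j) (x (j + 1)))) ∧
    A = ⋃ i ≤ n, segment ℝ (x i) (x (i + 1))

/-- A crossing-free drawing of `G` in the plane: vertices are distinct points, every edge is an arc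
between its two ends, an arc passes through no vertex other than its two ends, and two different
arcs have no point in common other than a common end. As usual in graph theory, an arc
is a simple polygonal arc; finite graphs that can be drawn with arbitrary simple curves
can be drawn with polygonal ones. -/
structure PlaneDrawing {V : Type*} (G : SimpleGraph V) where
  pos : V → ℝ × ℝ
  arc : Sym2 V → Set (ℝ × ℝ)
  pos_injective : Function.Injective pos
  isPolygonalArc : ∀ u v, G.Adj u v → IsPolygonalArc (pos u) (pos v) (arc s(u, v))
  mem_of_pos_mem : ∀ e ∈ G.edgeSet, ∀ w, pos w ∈ arc e → w ∈ e
  inter_subset : ∀ e ∈ G.edgeSet, ∀ f ∈ G.edgeSet, e ≠ f →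
    arc e ∩ arc f ⊆ pos '' {w | w ∈ e ∧ w ∈ f}

/-- A (finite) graph is planar if it has a crossing-free drawing in the plane. -/
def IsPlanar {V : Type*} (G : SimpleGraph V) : Prop := Nonempty (PlaneDrawing G)

end WeakUnitInterval

/-!
The idea is a count of faces in which the few triangular faces are charged to vertices.

*Weak unit interval graphs have few triangles.* If `c` is a vertex whose neighborhood contains a
cycle through the edge `vw`, some labeling has no representation: `vw` is far, `cv` and `cw` are
near, the other edges at `c` are far, and all other edges are near. So the neighbors of each vertex
induce a forest (`IsWeakUnitIntervalGraph.isAcyclic_induce_neighborSet`), a vertex of degree `d ≥ 1`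
lies in at most `d - 1` triangles, and without isolated vertices the number `t` of triangles
satisfies `3 t ≤ 2 |E| - |V|`.

*Planar graphs with few triangles have few edges.* Euler's formula and a count of the sides of
faces give `2 |E| + 8 ≤ 4 |V| + t` for `|V| ≥ 4` (`IsPlanar.two_mul_card_edgeSet_add_le`). Both bounds
together give `4 |E| + 24 ≤ 11 |V|`. This is the second claim, and applied to subgraphs it bounds the
average degree below `11 / 2`; subgraphs with at most three vertices have average degree at most two.

*Euler's inequality without topology.* Faces are replaced by linear functionals on the cycle space
`Z` of `G` over `𝔽₂`. A point off the drawing gives the functional that counts, modulo two, how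
often a cycle passes above the point. The functionals on the two sides of an edge `e` differ by the
coordinate `e`. These functionals, `U e` and `U e + a e`, have the following properties
(`IsPlanar.exists_sides`).

* Around each vertex, every function of the sides changes an even number of times. Hence the set of
  edges with a given functional on exactly one side, the boundary of that face, is even. If it is
  not empty, it has at least four edges or is a triangle.
* A function of the sides that changes across no edge is constant. Hence two faces with the same
  nonempty boundary are the only ones.

Since the differences of sides are all the coordinates, more than `dim Z` functionals have a nonempty
boundary unless `Z = 0`, and `dim Z > |E| - |V|`. Each edge is on at most two boundaries, and the
inequality follows.

The properties of the sides are proved for a system of straight segments with common ends, to which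
a polygonal drawing is reduced by a shear that makes all abscissas distinct. That the functional
above a segment does not depend on the abscissa (`SegmentSystem.sum_above_eq`) is the part of the
Jordan curve theorem that is needed: the parities at two abscissas differ by a sum of degrees of the
cycle at the vertices lying above the segment between these abscissas.
-/

namespace WeakUnitInterval

/-! ### Systems of segments and their vertical order -/

open Classical in
/-- Telescoping along a finite set ordered by an injective key: if the value just above `s` is `T`
plus the total weight of the elements with larger key, then the values of `g` on the two sides of
the elements sum to the values of `g` at the two extremes (`g` has values in characteristic two). -/
theorem sum_sides_eq {S M : Type*} [AddCommGroup M] (key : S → ℝ) (a : S → M) (g : M → ZMod 2)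
    (T : M) (A : Finset S) (hkey : Set.InjOn key A) :
    ∑ s ∈ A, (g (T + ∑ t ∈ A with key s < key t, a t) +
      g (T + ∑ t ∈ A with key s < key t, a t + a s)) = g T + g (T + ∑ t ∈ A, a t) := by
  induction A using Finset.induction_on_min_value key with
  | empty => simp [ZModModule.add_self]
  | insert s A hs hmin ih =>
    have hlt : ∀ t ∈ A, key s < key t := fun t ht => lt_of_le_of_ne (hmin t ht) fun h =>
      hs (hkey (by simp) (by simp [ht]) h ▸ ht)
    have h1 : ∀ u ∈ A, (insert s A).filter (fun t => key u < key t) =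
        A.filter (fun t => key u < key t) := by
      intro u hu
      rw [Finset.filter_insert, if_neg (not_lt.2 (hlt u hu).le)]
    have h2 : (insert s A).filter (fun t => key s < key t) = A := by
      rw [Finset.filter_insert, if_neg (lt_irrefl _), Finset.filter_true_of_mem hlt]
    rw [Finset.sum_insert hs, Finset.sum_insert hs, h2]
    have h3 := ih (hkey.mono (by simp))
    have h4 : ∀ u ∈ A, g (T + ∑ t ∈ insert s A with key u < key t, a t) +
        g (T + ∑ t ∈ insert s A with key u < key t, a t + a u) =
        g (T + ∑ t ∈ A with key u < key t, a t) +
        g (T + ∑ t ∈ A with key u < key t, a t + a u) := fun u hu => by rw [h1 u hu]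
    rw [Finset.sum_congr rfl h4, h3, add_assoc T, add_comm (a s)]
    have := ZModModule.add_self (g (T + ∑ t ∈ A, a t))
    linear_combination this

/-- A finite family of nondegenerate segments in the plane, none of them vertical, each given by
its left and its right end. Two segments meet only in common ends, and distinct ends have distinct
abscissas. -/
structure SegmentSystem (S : Type*) where
  left : S → ℝ × ℝ
  right : S → ℝ × ℝ
  left_lt_right : ∀ s, (left s).1 < (right s).1
  eq_end_of_mem : ∀ s t, s ≠ t → ∀ p ∈ segment ℝ (left s) (right s),
    p ∈ segment ℝ (left t) (right t) → p = left s ∨ p = right s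
  generic : ∀ p ∈ Set.range left ∪ Set.range right, ∀ q ∈ Set.range left ∪ Set.range right,
    p.1 = q.1 → p = q

namespace SegmentSystem

variable {S : Type*} (Γ : SegmentSystem S)

/-- The slope of a segment. -/
noncomputable def slope (s : S) : ℝ :=
  ((Γ.right s).2 - (Γ.left s).2) / ((Γ.right s).1 - (Γ.left s).1)

/-- The ordinate at abscissa `x` of the line through the segment `s`. -/
noncomputable def height (s : S) (x : ℝ) : ℝ :=
  (Γ.left s).2 + (x - (Γ.left s).1) * Γ.slope s

@[simp] theorem height_left (s : S) : Γ.height s (Γ.left s).1 = (Γ.left s).2 := by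
  simp [height]

@[simp] theorem height_right (s : S) : Γ.height s (Γ.right s).1 = (Γ.right s).2 := by
  have := Γ.left_lt_right s
  have h : (Γ.right s).1 - (Γ.left s).1 ≠ 0 := by linarith
  rw [height, slope, mul_div_cancel₀ _ h]
  ring

theorem height_eq_right (s : S) (x : ℝ) :
    Γ.height s x = (Γ.right s).2 + (x - (Γ.right s).1) * Γ.slope s := by
  rw [← Γ.height_right, height, height]
  ring

theorem height_mem_segment (s : S) {x : ℝ} (h1 : (Γ.left s).1 ≤ x) (h2 : x ≤ (Γ.right s).1) :
    (x, Γ.height s x) ∈ segment ℝ (Γ.left s) (Γ.right s) := by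
  have := Γ.left_lt_right s
  have h : (Γ.right s).1 - (Γ.left s).1 ≠ 0 := by linarith
  refine ⟨((Γ.right s).1 - x) / ((Γ.right s).1 - (Γ.left s).1),
    (x - (Γ.left s).1) / ((Γ.right s).1 - (Γ.left s).1), ?_, ?_, ?_, ?_⟩
  · exact div_nonneg (by linarith) (by linarith)
  · exact div_nonneg (by linarith) (by linarith)
  · field_simp
    ring
  · ext
    · simp
      field_simp
      ring
    · simp [height, slope]
      field_simp
      ring

/-- The abscissa `x` belongs to both segments, and is interior to at least one of them. At such an
abscissa two different segments have different heights. -/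
def Overlap (s t : S) (x : ℝ) : Prop :=
  (Γ.left s).1 ≤ x ∧ x ≤ (Γ.right s).1 ∧ (Γ.left t).1 ≤ x ∧ x ≤ (Γ.right t).1 ∧
    (((Γ.left s).1 < x ∧ x < (Γ.right s).1) ∨ ((Γ.left t).1 < x ∧ x < (Γ.right t).1))

theorem height_ne {s t : S} (hst : s ≠ t) {x : ℝ} (h : Γ.Overlap s t x) :
    Γ.height s x ≠ Γ.height t x := by
  intro he
  obtain ⟨h1, h2, h3, h4, h5⟩ := h
  have hs := Γ.height_mem_segment s h1 h2
  have ht := Γ.height_mem_segment t h3 h4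
  rw [← he] at ht
  rcases h5 with h5 | h5
  · rcases Γ.eq_end_of_mem s t hst _ hs ht with h | h
    · exact h5.1.ne (congrArg Prod.fst h).symm
    · exact h5.2.ne (congrArg Prod.fst h)
  · rcases Γ.eq_end_of_mem t s hst.symm _ ht hs with h | h
    · exact h5.1.ne (congrArg Prod.fst h).symm
    · exact h5.2.ne (congrArg Prod.fst h)

theorem continuous_height (s : S) : Continuous (Γ.height s) := by
  unfold height
  fun_prop

/-- Two segments do not change their vertical order: by continuity they would have to cross. -/
theorem height_lt_of_height_lt {s t : S} {x y : ℝ} (hx : Γ.Overlap s t x)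
    (hy : Γ.Overlap s t y) (h : Γ.height s x < Γ.height t x) :
    Γ.height s y < Γ.height t y := by
  have hst : s ≠ t := by
    rintro rfl
    exact lt_irrefl _ h
  by_contra hcon
  have hcont : ContinuousOn (fun z => Γ.height t z - Γ.height s z) (Set.uIcc x y) :=
    ((Γ.continuous_height t).sub (Γ.continuous_height s)).continuousOn
  obtain ⟨z, hz, hz0⟩ := intermediate_value_uIcc hcont (show (0 : ℝ) ∈ _ from
    Set.mem_uIcc.2 (Or.inr ⟨by linarith, by linarith⟩))
  have hzx : z ≠ x := by
    rintro rfl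
    simp only at hz0
    linarith
  have hzy : z ≠ y := by
    rintro rfl
    exact Γ.height_ne hst hy (by simp only at hz0; linarith)
  have hO : Γ.Overlap s t z := by
    obtain ⟨a1, a2, a3, a4, -⟩ := hx
    obtain ⟨b1, b2, b3, b4, -⟩ := hy
    rcases Set.mem_uIcc.1 hz with ⟨c1, c2⟩ | ⟨c1, c2⟩
    · have d1 := lt_of_le_of_ne c1 hzx.symm
      have d2 := lt_of_le_of_ne c2 hzy
      exact ⟨by linarith, by linarith, by linarith, by linarith, Or.inl ⟨by linarith, by linarith⟩⟩
    · have d1 := lt_of_le_of_ne c1 hzy.symm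
      have d2 := lt_of_le_of_ne c2 hzx
      exact ⟨by linarith, by linarith, by linarith, by linarith, Or.inl ⟨by linarith, by linarith⟩⟩
  exact Γ.height_ne hst hO (by simp only at hz0; linarith)

/-- The segment `t` runs above the segment `s` over the abscissas that they share. -/
def Above (s t : S) : Prop := ∃ y, Γ.Overlap s t y ∧ Γ.height s y < Γ.height t y

theorem above_iff {s t : S} {x : ℝ} (hx : Γ.Overlap s t x) :
    Γ.Above s t ↔ Γ.height s x < Γ.height t x :=
  ⟨fun ⟨_, hy, h⟩ => Γ.height_lt_of_height_lt hy hx h, fun h => ⟨x, hx, h⟩⟩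

variable [Fintype S] {M : Type*} [AddCommGroup M]

open Classical in
/-- A weight on the segments is a flow if the weights of the segments at each point sum to zero. -/
def IsFlow (a : S → M) : Prop :=
  ∀ p, ∑ s, ((if Γ.left s = p then a s else 0) + (if Γ.right s = p then a s else 0)) = 0

open Classical in
theorem IsFlow.sum_region {a : S → M} (ha : Γ.IsFlow a) (R : ℝ × ℝ → Prop) :
    ∑ s, ((if R (Γ.left s) then a s else 0) + (if R (Γ.right s) then a s else 0)) = 0 := by
  set P : Finset (ℝ × ℝ) := (Finset.univ.image Γ.left ∪ Finset.univ.image Γ.right).filter R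
  have h : ∑ p ∈ P, ∑ s, ((if Γ.left s = p then a s else 0) +
      (if Γ.right s = p then a s else 0)) = 0 := Finset.sum_eq_zero fun p _ => ha p
  rw [Finset.sum_comm] at h
  refine Eq.trans (Finset.sum_congr rfl fun s _ => ?_) h
  rw [Finset.sum_add_distrib, Finset.sum_ite_eq, Finset.sum_ite_eq]
  simp [P]

variable [Module (ZMod 2) M]

open Classical in
/-- The total weight above `s` is the same at the abscissas `x < x'`: the two totals differ by the
flow out of the ends lying above `s` strictly between `x` and `x'`. -/
theorem sum_above_eq {a : S → M} (ha : Γ.IsFlow a) (s : S) {x x' : ℝ}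
    (h1 : (Γ.left s).1 ≤ x) (h2 : x < x') (h3 : x' ≤ (Γ.right s).1) :
    ∑ t, (if Γ.Above s t ∧ (Γ.left t).1 ≤ x ∧ x < (Γ.right t).1 then a t else 0) =
      ∑ t, (if Γ.Above s t ∧ (Γ.left t).1 < x' ∧ x' ≤ (Γ.right t).1 then a t else 0) := by
  have hR := ha.sum_region Γ (fun p => x < p.1 ∧ p.1 < x' ∧ Γ.height s p.1 < p.2)
  rw [← sub_eq_zero, ZModModule.sub_eq_add, ← Finset.sum_add_distrib]
  refine Eq.trans (Finset.sum_congr rfl fun t _ => ?_) hR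
  have hlt := Γ.left_lt_right t
  have hL : (x < (Γ.left t).1 ∧ (Γ.left t).1 < x' ∧
      Γ.height s (Γ.left t).1 < (Γ.left t).2) ↔
      (x < (Γ.left t).1 ∧ (Γ.left t).1 < x' ∧ Γ.Above s t) := by
    refine and_congr_right fun b1 => and_congr_right fun b2 => ?_
    rw [Γ.above_iff ⟨(h1.trans_lt b1).le, (b2.trans_le h3).le, le_rfl, hlt.le,
      Or.inl ⟨h1.trans_lt b1, b2.trans_le h3⟩⟩, height_left]
  have hRt : (x < (Γ.right t).1 ∧ (Γ.right t).1 < x' ∧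
      Γ.height s (Γ.right t).1 < (Γ.right t).2) ↔
      (x < (Γ.right t).1 ∧ (Γ.right t).1 < x' ∧ Γ.Above s t) := by
    refine and_congr_right fun b1 => and_congr_right fun b2 => ?_
    rw [Γ.above_iff ⟨(h1.trans_lt b1).le, (b2.trans_le h3).le, hlt.le, le_rfl,
      Or.inl ⟨h1.trans_lt b1, b2.trans_le h3⟩⟩, height_right]
  simp only [hL, hRt]
  have h0 := ZModModule.add_self (a t)
  by_cases hab : Γ.Above s t
  · simp only [hab, true_and, and_true]
    split_ifs <;> first | (simp [h0]; done) | (exfalso; grind)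
  · simp [hab]

end SegmentSystem

/-! ### The two sides of a segment -/

open Classical in
/-- If `g` does not change across any element, it is constant from `T` downwards. -/
theorem eq_of_sides_eq {S M : Type*} [AddCommGroup M] (key : S → ℝ) (a : S → M) (g : M → ZMod 2)
    (T : M) (A : Finset S) (hkey : Set.InjOn key A)
    (hg : ∀ s ∈ A, g (T + ∑ t ∈ A with key s < key t, a t) =
      g (T + ∑ t ∈ A with key s < key t, a t + a s)) (s : S) :
    g (T + ∑ t ∈ A with key s < key t, a t) = g T := by
  have h := sum_sides_eq key a g T (A.filter fun t => key s < key t)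
    (hkey.mono (Finset.coe_subset.2 (Finset.filter_subset _ _)))
  rw [Finset.sum_eq_zero] at h
  · rw [← sub_eq_zero, ZModModule.sub_eq_add, add_comm, ← h]
  · intro u hu
    rw [Finset.mem_filter] at hu
    have : (A.filter fun t => key s < key t).filter (fun t => key u < key t) =
        A.filter fun t => key u < key t := by
      ext t
      simp only [Finset.mem_filter]
      exact ⟨fun h => ⟨h.1.1, h.2⟩, fun h => ⟨⟨h.1, hu.2.trans h.2⟩, h.2⟩⟩
    rw [this, ← hg u hu.1, ZModModule.add_self]

namespace SegmentSystem

variable {S : Type*} (Γ : SegmentSystem S)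

theorem above_iff_of_right_eq {s t : S} (h : Γ.right t = Γ.right s) :
    Γ.Above s t ↔ Γ.slope t < Γ.slope s := by
  have h1 := Γ.left_lt_right s
  have h2 := Γ.left_lt_right t
  rw [h] at h2
  obtain ⟨y, hy, hy'⟩ := exists_between (max_lt h1 h2)
  obtain ⟨h3, h4⟩ := max_lt_iff.1 hy
  rw [Γ.above_iff (x := y) ⟨h3.le, hy'.le, h4.le, by rw [h]; exact hy'.le, Or.inl ⟨h3, hy'⟩⟩,
    height_eq_right, height_eq_right, h, add_lt_add_iff_left,
    mul_lt_mul_left_of_neg (by linarith)]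

theorem above_iff_of_left_eq {s t : S} (h : Γ.left t = Γ.left s) :
    Γ.Above s t ↔ Γ.slope s < Γ.slope t := by
  have h1 := Γ.left_lt_right s
  have h2 := Γ.left_lt_right t
  rw [h] at h2
  obtain ⟨y, hy, hy'⟩ := exists_between (lt_min h1 h2)
  obtain ⟨h3, h4⟩ := lt_min_iff.1 hy'
  rw [Γ.above_iff (x := y) ⟨hy.le, h3.le, by rw [h]; exact hy.le, h4.le, Or.inl ⟨hy, h3⟩⟩,
    height, height, h, add_lt_add_iff_left, mul_lt_mul_iff_right₀ (by linarith)]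

theorem above_or_above {s t : S} (hst : s ≠ t) {y : ℝ} (hy : Γ.Overlap s t y) :
    Γ.Above s t ∨ Γ.Above t s := by
  have hy' : Γ.Overlap t s y := ⟨hy.2.2.1, hy.2.2.2.1, hy.1, hy.2.1, hy.2.2.2.2.symm⟩
  rw [Γ.above_iff hy, Γ.above_iff hy']
  exact lt_or_gt_of_ne (Γ.height_ne hst hy)

theorem slope_injOn_right (p : ℝ × ℝ) : Set.InjOn Γ.slope {s | Γ.right s = p} := by
  rintro s rfl t ht h
  by_contra hst
  have h1 := Γ.left_lt_right s
  have h2 := Γ.left_lt_right t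
  rw [ht] at h2
  obtain ⟨y, hy, hy'⟩ := exists_between (max_lt h1 h2)
  obtain ⟨h3, h4⟩ := max_lt_iff.1 hy
  rcases Γ.above_or_above hst (y := y)
    ⟨h3.le, hy'.le, h4.le, by rw [ht]; exact hy'.le, Or.inl ⟨h3, hy'⟩⟩ with h5 | h5
  · exact ((Γ.above_iff_of_right_eq ht).1 h5).ne h.symm
  · exact ((Γ.above_iff_of_right_eq ht.symm).1 h5).ne h

theorem slope_injOn_left (p : ℝ × ℝ) : Set.InjOn Γ.slope {s | Γ.left s = p} := by
  rintro s rfl t ht h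
  by_contra hst
  have h1 := Γ.left_lt_right s
  have h2 := Γ.left_lt_right t
  rw [ht] at h2
  obtain ⟨y, hy, hy'⟩ := exists_between (lt_min h1 h2)
  obtain ⟨h3, h4⟩ := lt_min_iff.1 hy'
  rcases Γ.above_or_above hst (y := y)
    ⟨hy.le, h3.le, by rw [ht]; exact hy.le, h4.le, Or.inl ⟨hy, h3⟩⟩ with h5 | h5
  · exact ((Γ.above_iff_of_left_eq ht).1 h5).ne h
  · exact ((Γ.above_iff_of_left_eq ht.symm).1 h5).ne h.symm

variable [Fintype S] {M : Type*} [AddCommGroup M]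

open Classical in
/-- The total weight of the segments above `s`, counted over the left end of `s`. It plays the role
of the face just above `s`; the face just below `s` is `aboveWeight a s + a s`. -/
noncomputable def aboveWeight (a : S → M) (s : S) : M :=
  ∑ t, (if Γ.Above s t ∧ (Γ.left t).1 ≤ (Γ.left s).1 ∧ (Γ.left s).1 < (Γ.right t).1 then a t else 0)

open Classical in
/-- The segments passing strictly above the point `p`. -/
noncomputable def passing (p : ℝ × ℝ) : Finset S :=
  {t | (Γ.left t).1 < p.1 ∧ p.1 < (Γ.right t).1 ∧ p.2 < Γ.height t p.1}

theorem mem_passing {p : ℝ × ℝ} {t : S} : t ∈ Γ.passing p ↔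
    (Γ.left t).1 < p.1 ∧ p.1 < (Γ.right t).1 ∧ p.2 < Γ.height t p.1 := by
  simp [passing]

open Classical in
/-- The segments with right end `p`. -/
noncomputable def incoming (p : ℝ × ℝ) : Finset S := {t | Γ.right t = p}

open Classical in
/-- The segments with left end `p`. -/
noncomputable def outgoing (p : ℝ × ℝ) : Finset S := {t | Γ.left t = p}

open Classical in
/-- The face above a segment that starts at `p`, read off from the segments at and above `p`. -/
theorem aboveWeight_eq_of_left (a : S → M) {s : S} {p : ℝ × ℝ} (hp : Γ.left s = p) :
    Γ.aboveWeight a s = ∑ t ∈ Γ.passing p, a t +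
      ∑ t ∈ Γ.outgoing p with Γ.slope s < Γ.slope t, a t := by
  subst hp
  rw [passing, outgoing, Finset.filter_filter, Finset.sum_filter, Finset.sum_filter,
    ← Finset.sum_add_distrib]
  refine Finset.sum_congr rfl fun t _ => ?_
  have hs := Γ.left_lt_right s
  have ht := Γ.left_lt_right t
  by_cases h : Γ.left t = Γ.left s
  · have h' : (Γ.left s).1 < (Γ.right t).1 := h ▸ ht
    simp [h, h', Γ.above_iff_of_left_eq h]
  · have h1 : (Γ.left t).1 ≠ (Γ.left s).1 := fun h1 => h (Γ.generic _ (by simp) _ (by simp) h1)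
    have h2 : (Γ.Above s t ∧ (Γ.left t).1 ≤ (Γ.left s).1 ∧ (Γ.left s).1 < (Γ.right t).1) ↔
        ((Γ.left t).1 < (Γ.left s).1 ∧ (Γ.left s).1 < (Γ.right t).1 ∧
          (Γ.left s).2 < Γ.height t (Γ.left s).1) := by
      rw [h1.le_iff_lt, and_comm, and_assoc]
      refine and_congr_right fun h3 => and_congr_right fun h4 => ?_
      rw [Γ.above_iff (x := (Γ.left s).1) ⟨le_rfl, hs.le, h3.le, h4.le, Or.inr ⟨h3, h4⟩⟩,
        height_left]
    simp [h, h2]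

variable [Module (ZMod 2) M] {a : S → M}

open Classical in
/-- The face above a segment that ends at `p`, read off from the segments at and above `p`. At a
right end, the lower of two segments has the larger slope. -/
theorem aboveWeight_eq_of_right (ha : Γ.IsFlow a) {s : S} {p : ℝ × ℝ} (hp : Γ.right s = p) :
    Γ.aboveWeight a s = ∑ t ∈ Γ.passing p, a t +
      ∑ t ∈ Γ.incoming p with -Γ.slope s < -Γ.slope t, a t := by
  subst hp
  have hs := Γ.left_lt_right s
  rw [aboveWeight, Γ.sum_above_eq ha s le_rfl hs le_rfl, passing, incoming, Finset.filter_filter,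
    Finset.sum_filter, Finset.sum_filter, ← Finset.sum_add_distrib]
  refine Finset.sum_congr rfl fun t _ => ?_
  have ht := Γ.left_lt_right t
  by_cases h : Γ.right t = Γ.right s
  · have h' : (Γ.left t).1 < (Γ.right s).1 := h ▸ ht
    simp [h, h', Γ.above_iff_of_right_eq h]
  · have h1 : (Γ.right s).1 ≠ (Γ.right t).1 := fun h1 =>
      h (Γ.generic _ (by simp) _ (by simp) h1.symm)
    have h2 : (Γ.Above s t ∧ (Γ.left t).1 < (Γ.right s).1 ∧ (Γ.right s).1 ≤ (Γ.right t).1) ↔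
        ((Γ.left t).1 < (Γ.right s).1 ∧ (Γ.right s).1 < (Γ.right t).1 ∧
          (Γ.right s).2 < Γ.height t (Γ.right s).1) := by
      rw [h1.le_iff_lt, and_comm, and_assoc]
      refine and_congr_right fun h3 => and_congr_right fun h4 => ?_
      rw [Γ.above_iff (x := (Γ.right s).1) ⟨hs.le, le_rfl, h3.le, h4.le, Or.inr ⟨h3, h4⟩⟩,
        height_right]
    simp [h, h2]

open Classical in
/-- The face above a segment can be read off at the abscissa of any end that lies below it. -/
theorem aboveWeight_eq_of_mem_passing (ha : Γ.IsFlow a) {s u : S} (hs : s ∈ Γ.passing (Γ.right u)) :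
    Γ.aboveWeight a s = ∑ t ∈ Γ.passing (Γ.right u) with
      Γ.height s (Γ.right u).1 < Γ.height t (Γ.right u).1, a t := by
  obtain ⟨h1, h2, h3⟩ := Γ.mem_passing.1 hs
  rw [aboveWeight, Γ.sum_above_eq ha s le_rfl h1 h2.le, passing, Finset.filter_filter,
    Finset.sum_filter]
  refine Finset.sum_congr rfl fun t _ => ?_
  congr 1
  refine propext ⟨fun ⟨b1, b2, b3⟩ => ?_, fun ⟨⟨b1, b2, b3⟩, b4⟩ => ?_⟩
  · rw [Γ.above_iff (x := (Γ.right u).1) ⟨h1.le, h2.le, b2.le, b3, Or.inl ⟨h1, h2⟩⟩] at b1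
    refine ⟨⟨b2, lt_of_le_of_ne b3 fun h => ?_, h3.trans b1⟩, b1⟩
    have h' := Γ.generic (Γ.right u) (by simp) (Γ.right t) (by simp) h
    rw [h', height_right, ← h'] at b1
    exact lt_asymm h3 b1
  · exact ⟨(Γ.above_iff ⟨h1.le, h2.le, b1.le, b2.le, Or.inl ⟨h1, h2⟩⟩).2 b4, b1, b2.le⟩

theorem sum_incoming_eq_sum_outgoing (ha : Γ.IsFlow a) (p : ℝ × ℝ) :
    ∑ t ∈ Γ.incoming p, a t = ∑ t ∈ Γ.outgoing p, a t := by
  classical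
  have h := ha p
  rw [Finset.sum_add_distrib, ← Finset.sum_filter, ← Finset.sum_filter] at h
  rw [← sub_eq_zero, ZModModule.sub_eq_add, add_comm]
  exact h

/-- At each end, every function of the faces changes an even number of times around that end. -/
theorem isFlow_sides (ha : Γ.IsFlow a) (g : M → ZMod 2) :
    Γ.IsFlow fun s => g (Γ.aboveWeight a s) + g (Γ.aboveWeight a s + a s) := by
  classical
  intro p
  rw [Finset.sum_add_distrib, ← Finset.sum_filter, ← Finset.sum_filter]
  have h1 := sum_sides_eq (fun s => -Γ.slope s) a g (∑ t ∈ Γ.passing p, a t) (Γ.incoming p)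
    (fun s hs t ht h => Γ.slope_injOn_right p (by simpa [incoming] using hs)
      (by simpa [incoming] using ht) (neg_injective h))
  have h2 := sum_sides_eq Γ.slope a g (∑ t ∈ Γ.passing p, a t) (Γ.outgoing p)
    (fun s hs t ht h => Γ.slope_injOn_left p (by simpa [outgoing] using hs)
      (by simpa [outgoing] using ht) h)
  rw [Γ.sum_incoming_eq_sum_outgoing ha, ← h2] at h1
  rw [← sub_eq_zero, ZModModule.sub_eq_add, add_comm] at h1
  refine Eq.trans (congrArg₂ (· + ·) ?_ ?_) h1
  · refine Finset.sum_congr rfl fun s hs => ?_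
    rw [Γ.aboveWeight_eq_of_left a (Finset.mem_filter.1 hs).2]
  · refine Finset.sum_congr rfl fun s hs => ?_
    rw [Γ.aboveWeight_eq_of_right ha (Finset.mem_filter.1 hs).2]

/-- A function of the faces that changes across no segment has the same value on every face as on
the unbounded one: from `s` one passes to the right end of `s`, and from there straight up. -/
theorem eq_of_forall_sides_eq (ha : Γ.IsFlow a) (g : M → ZMod 2)
    (hg : ∀ s, g (Γ.aboveWeight a s) = g (Γ.aboveWeight a s + a s)) (s : S) :
    g (Γ.aboveWeight a s) = g 0 := by
  classical
  have h1 : g (Γ.aboveWeight a s) = g (∑ t ∈ Γ.passing (Γ.right s), a t) := by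
    rw [Γ.aboveWeight_eq_of_right ha rfl]
    refine eq_of_sides_eq (fun s => -Γ.slope s) a g _ (Γ.incoming (Γ.right s)) ?_ ?_ s
    · exact fun u hu t ht h => Γ.slope_injOn_right (Γ.right s) (by simpa [incoming] using hu)
        (by simpa [incoming] using ht) (neg_injective h)
    · intro u hu
      rw [← Γ.aboveWeight_eq_of_right ha (Finset.mem_filter.1 hu).2]
      exact hg u
  have h2 := sum_sides_eq (fun t => Γ.height t (Γ.right s).1) a g 0 (Γ.passing (Γ.right s)) (by
    intro u hu t ht h
    by_contra hut
    obtain ⟨b1, b2, -⟩ := Γ.mem_passing.1 hu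
    obtain ⟨c1, c2, -⟩ := Γ.mem_passing.1 ht
    exact Γ.height_ne hut ⟨b1.le, b2.le, c1.le, c2.le, Or.inl ⟨b1, b2⟩⟩ h)
  rw [Finset.sum_eq_zero, zero_add] at h2
  · rw [h1, ← sub_eq_zero, ZModModule.sub_eq_add, add_comm, ← h2]
  · intro u hu
    rw [zero_add, ← Γ.aboveWeight_eq_of_mem_passing ha hu, ← hg u, ZModModule.add_self]

end SegmentSystem

/-! ### Systems of polygonal chains -/

theorem sum_range_add_succ {M : Type*} [AddCommGroup M] [Module (ZMod 2) M] (h : ℕ → M) (n : ℕ) :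
    ∑ i ∈ Finset.range (n + 1), (h i + h (i + 1)) = h 0 + h (n + 1) := by
  induction n with
  | zero => simp
  | succ n ih =>
    rw [Finset.sum_range_succ, ih, add_assoc, ← add_assoc (h (n + 1)), ZModModule.add_self,
      zero_add]

/-- A finite set of points in the plane is mapped injectively to the first coordinate axis by some
shear: each pair of points excludes at most one of them. -/
theorem exists_shear_injOn {Q : Set (ℝ × ℝ)} (hQ : Q.Finite) :
    ∃ ε : ℝ, Set.InjOn (fun p : ℝ × ℝ => p.1 + ε * p.2) Q := by
  have hfin : (⋃ p ∈ Q, ⋃ q ∈ Q, {ε : ℝ | p ≠ q ∧ p.1 + ε * p.2 = q.1 + ε * q.2}).Finite := by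
    refine hQ.biUnion fun p _ => hQ.biUnion fun q _ => Set.Subsingleton.finite ?_
    rintro ε ⟨hpq, h1⟩ ε' ⟨-, h2⟩
    by_contra hne
    have h3 : (ε - ε') * (p.2 - q.2) = 0 := by linear_combination h1 - h2
    have h4 : p.2 = q.2 := by
      rcases mul_eq_zero.1 h3 with h | h
      · exact absurd (sub_eq_zero.1 h) hne
      · exact sub_eq_zero.1 h
    exact hpq (Prod.ext (by rw [h4] at h1; linarith) h4)
  obtain ⟨ε, hε⟩ := hfin.infinite_compl.nonempty
  refine ⟨ε, fun p hp q hq h => ?_⟩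
  by_contra hpq
  exact hε (Set.mem_biUnion hp (Set.mem_biUnion hq ⟨hpq, h⟩))

/-- A finite family of simple polygonal chains in the plane; the chain `e` has the vertices
`x e 0, …, x e (n e + 1)`. Two chains meet only in their ends. -/
structure ChainSystem (E : Type*) where
  n : E → ℕ
  x : E → ℕ → ℝ × ℝ
  ne_succ : ∀ e, ∀ i ≤ n e, x e i ≠ x e (i + 1)
  inter_succ : ∀ e, ∀ i < n e, segment ℝ (x e i) (x e (i + 1)) ∩
    segment ℝ (x e (i + 1)) (x e (i + 2)) = {x e (i + 1)}
  disjoint : ∀ e, ∀ i j, i + 1 < j → j ≤ n e →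
    Disjoint (segment ℝ (x e i) (x e (i + 1))) (segment ℝ (x e j) (x e (j + 1)))
  eq_end : ∀ e f, e ≠ f → ∀ i ≤ n e, ∀ j ≤ n f, ∀ p ∈ segment ℝ (x e i) (x e (i + 1)),
    p ∈ segment ℝ (x f j) (x f (j + 1)) → p = x e 0 ∨ p = x e (n e + 1)

namespace ChainSystem

variable {E : Type*} (C : ChainSystem E)

/-- A vertex of a chain lies only on the segments of which it is an end. -/
theorem index_of_mem_segment {e : E} {i j : ℕ} (hi : i ≤ C.n e + 1) (hj : j ≤ C.n e)
    (h : C.x e i ∈ segment ℝ (C.x e j) (C.x e (j + 1))) : i = j ∨ i = j + 1 := by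
  by_contra! hne
  rcases lt_or_gt_of_ne hne.1 with hij | hij
  · have h0 := left_mem_segment ℝ (C.x e i) (C.x e (i + 1))
    rcases eq_or_lt_of_le (Nat.succ_le_of_lt hij) with h1 | h1
    · subst h1
      have := C.inter_succ e i (by omega)
      have h2 : C.x e i ∈ ({C.x e (i + 1)} : Set _) := this ▸ ⟨h0, h⟩
      exact C.ne_succ e i (by omega) h2
    · exact Set.disjoint_left.1 (C.disjoint e i j h1 hj) h0 h
  · obtain ⟨k, rfl⟩ : ∃ k, i = k + 1 := ⟨i - 1, by omega⟩
    have h0 := right_mem_segment ℝ (C.x e k) (C.x e (k + 1))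
    rcases eq_or_lt_of_le (show j + 1 ≤ k by omega) with h1 | h1
    · subst h1
      have := C.inter_succ e j (by omega)
      have h2 : C.x e (j + 1 + 1) ∈ ({C.x e (j + 1)} : Set _) := this ▸ ⟨h, h0⟩
      exact C.ne_succ e (j + 1) (by omega) h2.symm
    · exact Set.disjoint_left.1 (C.disjoint e j k h1 (by omega)) h h0

theorem ne_first {e : E} {i : ℕ} (hi : 0 < i) (hi' : i ≤ C.n e) : C.x e i ≠ C.x e 0 := by
  intro h
  have h1 : C.x e i ∈ segment ℝ (C.x e 0) (C.x e (0 + 1)) := by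
    rw [h]
    exact left_mem_segment _ _ _
  rcases C.index_of_mem_segment (by omega) (Nat.zero_le _) h1 with h2 | h2
  · omega
  · subst h2
    exact C.ne_succ e 0 (Nat.zero_le _) h.symm

theorem ne_last {e : E} {i : ℕ} (hi' : i ≤ C.n e) : C.x e i ≠ C.x e (C.n e + 1) := by
  intro h
  have h0 := right_mem_segment ℝ (C.x e (C.n e)) (C.x e (C.n e + 1))
  have h1 : C.x e i ∈ segment ℝ (C.x e (C.n e)) (C.x e (C.n e + 1)) := by
    rw [h]
    exact h0
  rcases C.index_of_mem_segment (by omega) le_rfl h1 with h2 | h2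
  · subst h2
    exact C.ne_succ e _ le_rfl h
  · omega

/-- The index type of the segments of all chains. -/
abbrev Seg : Type _ := Σ e : E, Fin (C.n e + 1)

/-- The horizontal shear with factor `ε`. -/
def shear (ε : ℝ) : (ℝ × ℝ) ≃ₗ[ℝ] (ℝ × ℝ) where
  toFun p := (p.1 + ε * p.2, p.2)
  invFun p := (p.1 - ε * p.2, p.2)
  map_add' p q := by ext <;> simp; ring
  map_smul' c p := by ext <;> simp; ring
  left_inv p := by ext <;> simp
  right_inv p := by ext <;> simp

theorem shear_mem_segment {ε : ℝ} {p q r : ℝ × ℝ} :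
    shear ε r ∈ segment ℝ (shear ε p) (shear ε q) ↔ r ∈ segment ℝ p q := by
  have h := image_segment ℝ (shear ε).toLinearMap.toAffineMap p q
  change _ = segment ℝ (shear ε p) (shear ε q) at h
  rw [← h]
  exact (shear ε).injective.mem_set_image

/-- The set of all vertices of the chains. -/
def points : Set (ℝ × ℝ) := {p | ∃ e, ∃ i ≤ C.n e + 1, C.x e i = p}

theorem finite_points [Finite E] : C.points.Finite := by
  refine (Set.finite_range fun s : Σ e : E, Fin (C.n e + 2) => C.x s.1 s.2).subset ?_
  rintro p ⟨e, i, hi, rfl⟩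
  exact ⟨⟨e, i, by omega⟩, rfl⟩

theorem left_mem_points (s : C.Seg) : C.x s.1 s.2 ∈ C.points := ⟨_, _, by omega, rfl⟩

theorem right_mem_points (s : C.Seg) : C.x s.1 (s.2 + 1) ∈ C.points := ⟨_, _, by omega, rfl⟩

theorem eq_end_of_mem_segment {s t : C.Seg} (hst : s ≠ t) {p : ℝ × ℝ}
    (hs : p ∈ segment ℝ (C.x s.1 s.2) (C.x s.1 (s.2 + 1)))
    (ht : p ∈ segment ℝ (C.x t.1 t.2) (C.x t.1 (t.2 + 1))) :
    p = C.x s.1 s.2 ∨ p = C.x s.1 (s.2 + 1) := by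
  obtain ⟨e, i, hi⟩ := s
  obtain ⟨f, j, hj⟩ := t
  simp only at hs ht ⊢
  by_cases hef : e = f
  · subst hef
    have hij : i ≠ j := fun h => hst (by subst h; rfl)
    rcases lt_or_gt_of_ne hij with h | h
    · rcases eq_or_lt_of_le (Nat.succ_le_of_lt h) with h1 | h1
      · subst h1
        have h2 := C.inter_succ e i (by omega)
        have h3 : p ∈ ({C.x e (i + 1)} : Set _) := h2 ▸ ⟨hs, ht⟩
        exact Or.inr h3
      · exact absurd ht (Set.disjoint_left.1 (C.disjoint e i j h1 (by omega)) hs)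
    · rcases eq_or_lt_of_le (Nat.succ_le_of_lt h) with h1 | h1
      · subst h1
        have h2 := C.inter_succ e j (by omega)
        have h3 : p ∈ ({C.x e (j + 1)} : Set _) := h2 ▸ ⟨ht, hs⟩
        exact Or.inl h3
      · exact absurd hs (Set.disjoint_left.1 (C.disjoint e j i h1 (by omega)) ht)
  · rcases C.eq_end e f hef i (by omega) j (by omega) p hs ht with h | h
    · rw [h] at hs
      rcases C.index_of_mem_segment (by omega) (by omega) hs with h1 | h1
      · exact Or.inl (by rw [h, ← h1])
      · exact Or.inr (by rw [h, ← h1])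
    · rw [h] at hs
      rcases C.index_of_mem_segment (by omega) (by omega) hs with h1 | h1
      · exact Or.inl (by rw [h, ← h1])
      · exact Or.inr (by rw [h, ← h1])

open Classical in
/-- The segments of the chains, after a shear that separates the abscissas of their vertices. -/
noncomputable def toSegmentSystem (ε : ℝ)
    (hε : Set.InjOn (fun p : ℝ × ℝ => p.1 + ε * p.2) C.points) : SegmentSystem C.Seg where
  left s := if (shear ε (C.x s.1 s.2)).1 < (shear ε (C.x s.1 (s.2 + 1))).1
    then shear ε (C.x s.1 s.2) else shear ε (C.x s.1 (s.2 + 1))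
  right s := if (shear ε (C.x s.1 s.2)).1 < (shear ε (C.x s.1 (s.2 + 1))).1
    then shear ε (C.x s.1 (s.2 + 1)) else shear ε (C.x s.1 s.2)
  left_lt_right s := by
    split_ifs with h
    · exact h
    · exact lt_of_le_of_ne (not_lt.1 h) fun h' => C.ne_succ s.1 s.2 (by omega)
        (hε (C.left_mem_points s) (C.right_mem_points s) h'.symm)
  eq_end_of_mem s t hst p hs ht := by
    obtain ⟨p, rfl⟩ := (shear ε).surjective p
    have hs' : p ∈ segment ℝ (C.x s.1 s.2) (C.x s.1 (s.2 + 1)) := by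
      split_ifs at hs
      · exact shear_mem_segment.1 hs
      · rw [segment_symm] at hs
        exact shear_mem_segment.1 hs
    have ht' : p ∈ segment ℝ (C.x t.1 t.2) (C.x t.1 (t.2 + 1)) := by
      split_ifs at ht
      · exact shear_mem_segment.1 ht
      · rw [segment_symm] at ht
        exact shear_mem_segment.1 ht
    rcases C.eq_end_of_mem_segment hst hs' ht' with h | h
    · rw [h]
      split_ifs <;> simp
    · rw [h]
      split_ifs <;> simp
  generic := by
    have key : ∀ p ∈ Set.range (fun s : C.Seg =>
          if (shear ε (C.x s.1 s.2)).1 < (shear ε (C.x s.1 (s.2 + 1))).1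
          then shear ε (C.x s.1 s.2) else shear ε (C.x s.1 (s.2 + 1))) ∪
        Set.range (fun s : C.Seg =>
          if (shear ε (C.x s.1 s.2)).1 < (shear ε (C.x s.1 (s.2 + 1))).1
          then shear ε (C.x s.1 (s.2 + 1)) else shear ε (C.x s.1 s.2)),
        ∃ q ∈ C.points, shear ε q = p := by
      rintro p (⟨s, rfl⟩ | ⟨s, rfl⟩)
      · simp only
        split_ifs
        · exact ⟨_, C.left_mem_points s, rfl⟩
        · exact ⟨_, C.right_mem_points s, rfl⟩
      · simp only
        split_ifs
        · exact ⟨_, C.right_mem_points s, rfl⟩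
        · exact ⟨_, C.left_mem_points s, rfl⟩
    intro p hp q hq h
    obtain ⟨p', hp', rfl⟩ := key p hp
    obtain ⟨q', hq', rfl⟩ := key q hq
    rw [hε hp' hq' h]

variable [Fintype E] {M : Type*} [AddCommGroup M]

open Classical in
/-- The flow condition for the sheared segments, in terms of the original chains: neither the shear
nor the orientation of the segments from left to right matters. -/
theorem isFlow_toSegmentSystem_iff (ε : ℝ)
    (hε : Set.InjOn (fun p : ℝ × ℝ => p.1 + ε * p.2) C.points) (b : C.Seg → M) :
    (C.toSegmentSystem ε hε).IsFlow b ↔ ∀ p, ∑ s : C.Seg,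
      ((if C.x s.1 s.2 = p then b s else 0) + (if C.x s.1 (s.2 + 1) = p then b s else 0)) = 0 := by
  rw [SegmentSystem.IsFlow, (shear ε).surjective.forall]
  refine forall_congr' fun p => ?_
  rw [Finset.sum_congr rfl fun s _ => ?_]
  simp only [toSegmentSystem]
  by_cases h : (shear ε (C.x s.1 s.2)).1 < (shear ε (C.x s.1 (s.2 + 1))).1
  · simp only [if_pos h, (shear ε).injective.eq_iff]
  · simp only [if_neg h, (shear ε).injective.eq_iff]
    rw [add_comm]

variable [Module (ZMod 2) M]

open Classical in
/-- For weights that are constant on chains only the ends of the chains matter. -/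
theorem sum_seg_eq (b : E → M) (p : ℝ × ℝ) :
    ∑ s : C.Seg, ((if C.x s.1 s.2 = p then b s.1 else 0) +
      (if C.x s.1 (s.2 + 1) = p then b s.1 else 0)) =
    ∑ e, ((if C.x e 0 = p then b e else 0) + (if C.x e (C.n e + 1) = p then b e else 0)) := by
  rw [Fintype.sum_sigma]
  refine Finset.sum_congr rfl fun e _ => ?_
  rw [← sum_range_add_succ (fun i => if C.x e i = p then b e else 0), Finset.sum_range]

open Classical in
/-- A flow takes the same value on all segments of a chain. -/
theorem eq_of_isFlow {b : C.Seg → M}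
    (hb : ∀ p, ∑ s : C.Seg, ((if C.x s.1 s.2 = p then b s else 0) +
      (if C.x s.1 (s.2 + 1) = p then b s else 0)) = 0) (e : E) (i : ℕ) (hi : i < C.n e + 1) :
    b ⟨e, i, hi⟩ = b ⟨e, 0, by omega⟩ := by
  induction i with
  | zero => rfl
  | succ i ih =>
    rw [← ih (by omega), ← sub_eq_zero, ZModModule.sub_eq_add, ← hb (C.x e (i + 1)),
      Fintype.sum_eq_add ⟨e, i + 1, hi⟩ ⟨e, i, by omega⟩]
    · have h1 := C.ne_succ e i (by omega)
      have h2 := C.ne_succ e (i + 1) (by omega)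
      simp [h1, h2.symm]
    · simp
    · rintro ⟨f, j, hj⟩ ⟨hne1, hne2⟩
      have hnot : C.x e (i + 1) ∉ segment ℝ (C.x f j) (C.x f (j + 1)) := by
        intro hmem
        by_cases hef : e = f
        · subst hef
          rcases C.index_of_mem_segment (by omega) (by omega) hmem with h | h
          · subst h
            exact hne1 rfl
          · obtain rfl : i = j := by omega
            exact hne2 rfl
        · rcases C.eq_end e f hef (i + 1) (by omega) j (by omega) _
            (left_mem_segment _ _ _) hmem with h | h
          · exact C.ne_first (by omega) (by omega) h
          · exact C.ne_last (by omega) h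
      rw [if_neg, if_neg, add_zero]
      · exact fun h => hnot (h ▸ right_mem_segment _ _ _)
      · exact fun h => hnot (h ▸ left_mem_segment _ _ _)

open Classical in
/-- The faces of a chain system: the side `U e` is the face above the first segment of the chain
`e`, and any other segment of the chain separates the same two faces if `a e ≠ 0`. -/
theorem exists_sides {a : E → M} (ha : ∀ p, ∑ e, ((if C.x e 0 = p then a e else 0) +
      (if C.x e (C.n e + 1) = p then a e else 0)) = 0) :
    ∃ U : E → M, (∀ (g : M → ZMod 2) (p : ℝ × ℝ),
      ∑ e, ((if C.x e 0 = p then g (U e) + g (U e + a e) else 0) +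
        (if C.x e (C.n e + 1) = p then g (U e) + g (U e + a e) else 0)) = 0) ∧
      ∀ g : M → ZMod 2, (∀ e, g (U e) = g (U e + a e)) → ∀ e, g (U e) = g 0 := by
  obtain ⟨ε, hε⟩ := exists_shear_injOn C.finite_points
  have hflow : (C.toSegmentSystem ε hε).IsFlow fun s => a s.1 := by
    rw [isFlow_toSegmentSystem_iff]
    intro p
    rw [sum_seg_eq, ha]
  set W := (C.toSegmentSystem ε hε).aboveWeight fun s => a s.1
  have hE : ∀ g : M → ZMod 2, ∀ p, ∑ s : C.Seg, ((if C.x s.1 s.2 = p then g (W s) + g (W s + a s.1)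
      else 0) + (if C.x s.1 (s.2 + 1) = p then g (W s) + g (W s + a s.1) else 0)) = 0 := fun g =>
    (C.isFlow_toSegmentSystem_iff ε hε _).1 (SegmentSystem.isFlow_sides _ hflow g)
  have hconst : ∀ (g : M → ZMod 2) (s : C.Seg),
      g (W s) + g (W s + a s.1) = g (W ⟨s.1, 0⟩) + g (W ⟨s.1, 0⟩ + a s.1) := fun g s =>
    C.eq_of_isFlow (hE g) s.1 s.2 s.2.2
  refine ⟨fun e => W ⟨e, 0⟩, fun g p => ?_, fun g hg e => ?_⟩
  · rw [← C.sum_seg_eq (fun e => g (W ⟨e, 0⟩) + g (W ⟨e, 0⟩ + a e))]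
    refine Eq.trans (Finset.sum_congr rfl fun s _ => ?_) (hE g p)
    rw [hconst g s]
  · refine SegmentSystem.eq_of_forall_sides_eq _ hflow g (fun s => ?_) _
    have h := hconst g s
    rw [hg s.1, ZModModule.add_self] at h
    rwa [← sub_eq_zero, ZModModule.sub_eq_add]

end ChainSystem

/-! ### The sides of the edges of a plane drawing -/

open Classical in
theorem sum_ends_eq {E V M : Type*} [Fintype E] [AddCommGroup M] {pos : V → ℝ × ℝ}
    (hpos : Function.Injective pos) {u v : E → V} (huv : ∀ e, u e ≠ v e) {ends : E → Sym2 V}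
    (hends : ∀ e, ends e = s(u e, v e)) {p q : E → ℝ × ℝ} (hp : ∀ e, p e = pos (u e))
    (hq : ∀ e, q e = pos (v e)) (b : E → M) (w : V) :
    ∑ e, ((if p e = pos w then b e else 0) + (if q e = pos w then b e else 0)) =
      ∑ e with w ∈ ends e, b e := by
  rw [Finset.sum_filter]
  refine Finset.sum_congr rfl fun e _ => ?_
  simp only [hp, hq, hends, hpos.eq_iff, Sym2.mem_iff]
  by_cases h1 : u e = w
  · have h2 : v e ≠ w := fun h2 => huv e (h1.trans h2.symm)
    simp [h1, h2]
  · by_cases h2 : v e = w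
    · simp [h1, h2]
    · simp [h1, h2, Ne.symm h1, Ne.symm h2]

open Classical in
/-- The faces of a plane drawing, as elements of an `𝔽₂`-vector space `M`. If weights on the edges
sum to zero around every vertex, then every edge `e` can be given two sides `U e` and `U e + a e` in
`M` so that every function of the sides changes an even number of times around each vertex, and is
constant if it changes across no edge. -/
theorem IsPlanar.exists_sides {V : Type*} [Fintype V] {G : SimpleGraph V} (hG : IsPlanar G)
    {M : Type*} [AddCommGroup M] [Module (ZMod 2) M] {a : G.edgeSet → M}
    (ha : ∀ v, ∑ e : G.edgeSet with v ∈ e.1, a e = 0) :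
    ∃ U : G.edgeSet → M,
      (∀ (g : M → ZMod 2) (v : V),
        ∑ e : G.edgeSet with v ∈ e.1, (g (U e) + g (U e + a e)) = 0) ∧
      ∀ g : M → ZMod 2, (∀ e, g (U e) = g (U e + a e)) → ∀ e, g (U e) = g 0 := by
  obtain ⟨D⟩ := hG
  have hex : ∀ e : G.edgeSet, ∃ u v, u ≠ v ∧ e.1 = s(u, v) ∧
      IsPolygonalArc (D.pos u) (D.pos v) (D.arc e.1) := by
    rintro ⟨e, he⟩
    induction e using Sym2.inductionOn with
    | hf u v => exact ⟨u, v, G.ne_of_adj he, rfl, D.isPolygonalArc u v he⟩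
  choose u v huv he n x hx0 hx1 hne hinter hdisj harc using hex
  have hmem : ∀ e, ∀ i ≤ n e, ∀ p ∈ segment ℝ (x e i) (x e (i + 1)), p ∈ D.arc e.1 := by
    intro e i hi p hp
    rw [harc]
    exact Set.mem_biUnion (x := i) hi hp
  let C : ChainSystem G.edgeSet :=
    { n := n
      x := x
      ne_succ := hne
      inter_succ := hinter
      disjoint := hdisj
      eq_end := by
        intro e f hef i hi j hj p hp hp'
        obtain ⟨w, ⟨hwe, -⟩, rfl⟩ := D.inter_subset e.1 e.2 f.1 f.2
          (fun h => hef (Subtype.ext h)) ⟨hmem e i hi p hp, hmem f j hj p hp'⟩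
        rw [he e, Sym2.mem_iff] at hwe
        rcases hwe with rfl | rfl
        · exact Or.inl (hx0 e).symm
        · exact Or.inr (hx1 e).symm }
  obtain ⟨U, hU1, hU2⟩ := C.exists_sides (a := a) (by
    intro p
    by_cases hp : ∃ w, D.pos w = p
    · obtain ⟨w, rfl⟩ := hp
      exact (sum_ends_eq D.pos_injective huv he hx0 hx1 a w).trans (ha w)
    · refine Finset.sum_eq_zero fun e _ => ?_
      simp only [C, hx0, hx1]
      rw [if_neg fun h => hp ⟨_, h⟩, if_neg fun h => hp ⟨_, h⟩, add_zero])
  exact ⟨U, fun g w => (sum_ends_eq D.pos_injective huv he hx0 hx1 _ w).symm.trans (hU1 g _), hU2⟩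

/-! ### The cycle space and Euler's inequality -/

open Classical in
/-- The cycle space of a graph over `𝔽₂`: the weights on the edges that sum to zero around every
vertex. -/
noncomputable def cycleSpace {V : Type*} [Fintype V] (G : SimpleGraph V) :
    Submodule (ZMod 2) (G.edgeSet → ZMod 2) where
  carrier := {z | ∀ v, ∑ e : G.edgeSet with v ∈ e.1, z e = 0}
  zero_mem' v := by simp
  add_mem' {y z} hy hz v := by
    have h1 := hy v
    have h2 := hz v
    simp only [Pi.add_apply, Finset.sum_add_distrib, h1, h2, add_zero]
  smul_mem' c z hz v := by
    have h1 := hz v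
    simp only [Pi.smul_apply, ← Finset.smul_sum, h1, smul_zero]

open Classical in
/-- The cycle space has dimension greater than `|E| - |A|`: it is the kernel of the boundary map,
whose image misses the indicator of a single vertex, as boundaries have total weight zero. -/
theorem card_edgeSet_lt_finrank_cycleSpace_add {V : Type*} [Fintype V] {G : SimpleGraph V}
    {A : Finset V} (hA : ∀ v w, G.Adj v w → v ∈ A) (hne : A.Nonempty) :
    Fintype.card G.edgeSet < Module.finrank (ZMod 2) (cycleSpace G) + A.card := by
  let L : (G.edgeSet → ZMod 2) →ₗ[ZMod 2] (A → ZMod 2) :=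
    { toFun := fun z v => ∑ e : G.edgeSet with v.1 ∈ e.1, z e
      map_add' := fun y z => by
        ext v
        simp [Finset.sum_add_distrib]
      map_smul' := fun c z => by
        ext v
        simp [Finset.mul_sum] }
  have hmemA : ∀ (v : V) (e : G.edgeSet), v ∈ e.1 → v ∈ A := by
    rintro v ⟨e, he⟩ hv
    obtain ⟨w, rfl⟩ := hv
    exact hA v w he
  have hker : LinearMap.ker L = cycleSpace G := by
    ext z
    rw [LinearMap.mem_ker]
    constructor
    · intro h v
      by_cases hv : v ∈ A
      · exact congrFun h ⟨v, hv⟩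
      · rw [Finset.sum_eq_zero]
        intro e he
        exact absurd (hmemA v e (Finset.mem_filter.1 he).2) hv
    · intro h
      ext v
      exact h v
  have hsum : ∀ z, ∑ v : A, L z v = 0 := by
    intro z
    change ∑ v : A, ∑ e : G.edgeSet with v.1 ∈ e.1, z e = 0
    rw [Finset.sum_coe_sort A fun v => ∑ e : G.edgeSet with v ∈ e.1, z e]
    simp only [Finset.sum_filter]
    rw [Finset.sum_comm]
    refine Finset.sum_eq_zero fun e _ => ?_
    rw [← Finset.sum_filter, Finset.sum_const]
    have h : (A.filter fun v => v ∈ e.1) = e.1.toFinset := by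
      ext v
      simp only [Finset.mem_filter, Sym2.mem_toFinset]
      exact ⟨fun h => h.2, fun h => ⟨hmemA v e h, h⟩⟩
    rw [h, Sym2.card_toFinset_of_not_isDiag _ (G.not_isDiag_of_mem_edgeSet e.2), two_smul,
      ZModModule.add_self]
  have hrange : LinearMap.range L ≠ ⊤ := by
    obtain ⟨v, hv⟩ := hne
    intro h
    obtain ⟨z, hz⟩ : Pi.single (⟨v, hv⟩ : A) (1 : ZMod 2) ∈ LinearMap.range L := h ▸ trivial
    have := hsum z
    rw [hz] at this
    simp at this
  have h1 := L.finrank_range_add_finrank_ker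
  have h2 := Submodule.finrank_lt hrange
  rw [Module.finrank_fintype_fun_eq_card] at h1 h2
  rw [hker] at h1
  rw [Fintype.card_coe] at h2
  omega

open Classical in
/-- A nonempty even set of edges of a simple graph has at least three elements, and it is the edge
set of a triangle if it has exactly three. -/
theorem three_le_card_of_even {V : Type*} [Fintype V] {G : SimpleGraph V} {D : Finset G.edgeSet}
    (hD : ∀ v, Even (D.filter fun e => v ∈ e.1).card) (hne : D.Nonempty) :
    3 ≤ D.card ∧ (D.card = 3 → ∃ T ∈ G.cliqueFinset 3, ∀ e : G.edgeSet, e ∈ D ↔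
      ∀ v ∈ e.1, v ∈ T) := by
  have hother : ∀ v, ∀ e ∈ D, v ∈ e.1 → ∃ f ∈ D, v ∈ f.1 ∧ f ≠ e := by
    intro v e he hv
    have h0 : e ∈ D.filter fun e => v ∈ e.1 := Finset.mem_filter.2 ⟨he, hv⟩
    have h1 : 1 < (D.filter fun e => v ∈ e.1).card := by
      have := Finset.card_pos.2 ⟨e, h0⟩
      obtain ⟨k, hk⟩ := hD v
      omega
    obtain ⟨f, hf, hfe⟩ := Finset.exists_mem_ne h1 e
    exact ⟨f, (Finset.mem_filter.1 hf).1, (Finset.mem_filter.1 hf).2, hfe⟩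
  obtain ⟨⟨e, he⟩, heD⟩ := hne
  induction e using Sym2.inductionOn with | hf u v => ?_
  have huv : u ≠ v := G.ne_of_adj he
  obtain ⟨⟨f, hf⟩, hfD, huf, hfe⟩ := hother u _ heD (by simp)
  obtain ⟨w, rfl⟩ := huf
  obtain ⟨⟨f', hf'⟩, hfD', hvf', hfe'⟩ := hother v _ heD (by simp)
  obtain ⟨z, rfl⟩ := hvf'
  have hwv : w ≠ v := by
    rintro rfl
    exact hfe rfl
  have huw : u ≠ w := G.ne_of_adj hf
  have hvz : v ≠ z := G.ne_of_adj hf'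
  have hff' : (⟨s(v, z), hf'⟩ : G.edgeSet) ≠ ⟨s(u, w), hf⟩ := by
    intro h
    rw [Subtype.mk.injEq, Sym2.eq_iff] at h
    rcases h with ⟨rfl, -⟩ | ⟨rfl, -⟩
    · exact huv rfl
    · exact hwv rfl
  have hcard : ({⟨s(u, v), he⟩, ⟨s(u, w), hf⟩, ⟨s(v, z), hf'⟩} : Finset G.edgeSet).card = 3 :=
    Finset.card_eq_three.2 ⟨_, _, _, hfe.symm, hfe'.symm, hff'.symm, rfl⟩
  have hsub : ({⟨s(u, v), he⟩, ⟨s(u, w), hf⟩, ⟨s(v, z), hf'⟩} : Finset G.edgeSet) ⊆ D := by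
    intro x hx
    simp only [Finset.mem_insert, Finset.mem_singleton] at hx
    rcases hx with rfl | rfl | rfl <;> assumption
  refine ⟨hcard ▸ Finset.card_le_card hsub, fun h3 => ?_⟩
  have hDeq := Finset.eq_of_subset_of_card_le hsub (by rw [hcard, h3])
  obtain ⟨⟨x, hx⟩, hxD, hwx, hxne⟩ := hother w _ hfD (by simp)
  have hwz : w = z := by
    rw [← hDeq] at hxD
    simp only [Finset.mem_insert, Finset.mem_singleton, Subtype.mk.injEq] at hxD
    rcases hxD with rfl | rfl | rfl
    · rcases Sym2.mem_iff.1 hwx with h | h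
      · exact absurd h.symm huw
      · exact absurd h hwv
    · exact absurd rfl hxne
    · rcases Sym2.mem_iff.1 hwx with h | h
      · exact absurd h hwv
      · exact h
  subst hwz
  refine ⟨{u, v, w}, ?_, ?_⟩
  · rw [SimpleGraph.mem_cliqueFinset_iff, SimpleGraph.is3Clique_triple_iff]
    exact ⟨he, hf, hf'⟩
  · rintro ⟨y, hy⟩
    rw [← hDeq]
    induction y using Sym2.inductionOn with | hf a b => ?_
    have hab : a ≠ b := G.ne_of_adj hy
    simp only [Finset.mem_insert, Finset.mem_singleton, Subtype.mk.injEq, Sym2.eq_iff,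
      Sym2.mem_iff, forall_eq_or_imp, forall_eq]
    grind

open Classical in
/-- Euler's inequality for planar graphs, in a form that keeps track of triangles: at most one face
for each triangle has three sides, the others have at least four. Here `A` is any set of at
least four vertices that contains all nonisolated ones. -/
theorem IsPlanar.two_mul_card_edgeSet_add_le {V : Type*} [Fintype V] {G : SimpleGraph V}
    (hG : IsPlanar G) {A : Finset V} (hA : ∀ v w, G.Adj v w → v ∈ A) (h4 : 4 ≤ A.card) :
    2 * Fintype.card G.edgeSet + 8 ≤ 4 * A.card + (G.cliqueFinset 3).card := by
  have hdim := card_edgeSet_lt_finrank_cycleSpace_add hA (Finset.card_pos.1 (by omega))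
  let a : G.edgeSet → Module.Dual (ZMod 2) (cycleSpace G) := fun e =>
    (LinearMap.proj e).comp (cycleSpace G).subtype
  obtain ⟨U, hU, hconn⟩ := hG.exists_sides (a := a) (by
    intro v
    ext z
    simpa [a] using z.2 v)
  -- The faces on the two sides of some edge that is not a bridge, and the boundaries of faces.
  let X : Finset (Module.Dual (ZMod 2) (cycleSpace G)) :=
    (Finset.univ.filter fun e => a e ≠ 0).biUnion fun e => {U e, U e + a e}
  let bd : Module.Dual (ZMod 2) (cycleSpace G) → Finset G.edgeSet := fun x =>
    Finset.univ.filter fun e => a e ≠ 0 ∧ (U e = x ∨ U e + a e = x)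
  have hX_iff : ∀ x, x ∈ X ↔ ∃ e, a e ≠ 0 ∧ (U e = x ∨ U e + a e = x) := by
    intro x
    simp only [X, Finset.mem_biUnion, Finset.mem_filter, Finset.mem_univ, true_and,
      Finset.mem_insert, Finset.mem_singleton, eq_comm (a := x)]
  have hmemX : ∀ e, a e ≠ 0 → U e ∈ X ∧ U e + a e ∈ X := fun e he =>
    ⟨(hX_iff _).2 ⟨e, he, Or.inl rfl⟩, (hX_iff _).2 ⟨e, he, Or.inr rfl⟩⟩
  have hbd_ne : ∀ x ∈ X, (bd x).Nonempty := by
    intro x hx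
    obtain ⟨e, he⟩ := (hX_iff x).1 hx
    exact ⟨e, by simpa [bd] using he⟩
  have hbd_even : ∀ x v, Even ((bd x).filter fun e => v ∈ e.1).card := by
    intro x v
    have h := hU (fun m => if m = x then 1 else 0) v
    have h' : ∀ e, ((if U e = x then 1 else 0) + (if U e + a e = x then 1 else 0) : ZMod 2) =
        if e ∈ bd x then 1 else 0 := by
      intro e
      by_cases h0 : a e = 0
      · simp [bd, h0, ZModModule.add_self]
      · by_cases h1 : U e = x
        · have h2 : U e + a e ≠ x := by rw [h1]; simpa using h0
          simp [bd, h0, h1]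
        · simp [bd, h0, h1]
    simp only [h'] at h
    rw [← Finset.sum_filter, Finset.filter_filter, Finset.sum_const, nsmul_one,
      ZMod.natCast_eq_zero_iff_even] at h
    convert h using 2
    ext e
    simp [and_comm]
  -- Each edge lies on at most two boundaries.
  have hsum : ∑ x ∈ X, (bd x).card ≤ 2 * Fintype.card G.edgeSet := by
    simp only [Finset.card_eq_sum_ones, bd, Finset.sum_filter]
    rw [Finset.sum_comm, mul_comm, ← smul_eq_mul, ← Finset.card_univ, ← Finset.sum_const]
    refine Finset.sum_le_sum fun e _ => ?_
    rw [← Finset.sum_filter, ← Finset.card_eq_sum_ones]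
    refine (Finset.card_le_card (t := {U e, U e + a e}) ?_).trans Finset.card_le_two
    intro x hx
    obtain ⟨-, -, h | h⟩ := Finset.mem_filter.1 hx <;> simp [h]
  -- A cycle is determined by the values of all faces relative to a fixed one.
  have hX : Module.finrank (ZMod 2) (cycleSpace G) ≤ X.card - 1 := by
    rcases X.eq_empty_or_nonempty with hXe | ⟨x₀, hx₀⟩
    · have hz : ∀ z : cycleSpace G, z = 0 := by
        intro z
        ext e
        have h : a e = 0 := by
          by_contra h
          simpa [hXe] using (hmemX e h).1
        exact LinearMap.congr_fun h z
      have : Subsingleton (cycleSpace G) := ⟨fun y z => (hz y).trans (hz z).symm⟩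
      rw [Module.finrank_zero_of_subsingleton]
      exact Nat.zero_le _
    · let Φ : cycleSpace G →ₗ[ZMod 2] ({x // x ∈ X.erase x₀} → ZMod 2) :=
        LinearMap.pi fun x => x.1 - x₀
      have hΦ : Function.Injective Φ := by
        rw [← LinearMap.ker_eq_bot, LinearMap.ker_eq_bot']
        intro z hz
        have hall : ∀ x ∈ X, x z = x₀ z := by
          intro x hx
          by_cases hxx : x = x₀
          · rw [hxx]
          · exact sub_eq_zero.1 (congrFun hz ⟨x, Finset.mem_erase.2 ⟨hxx, hx⟩⟩)
        ext e
        by_cases h : a e = 0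
        · exact LinearMap.congr_fun h z
        · have h1 := (hall _ (hmemX e h).2).trans (hall _ (hmemX e h).1).symm
          rw [LinearMap.add_apply, add_eq_left] at h1
          exact h1
      have h := LinearMap.finrank_le_finrank_of_injective hΦ
      rwa [Module.finrank_fintype_fun_eq_card, Fintype.card_coe, Finset.card_erase_of_mem hx₀] at h
  -- If two faces have the same boundary, there is no other face.
  have hinj : 3 ≤ X.card → Set.InjOn bd X := by
    intro h3 x hx y hy hxy
    by_contra hne
    have hcard : ({x, y} : Finset _).card < X.card := Finset.card_le_two.trans_lt h3
    obtain ⟨z, hz, hzxy⟩ := Finset.exists_mem_notMem_of_card_lt_card hcard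
    let g : Module.Dual (ZMod 2) (cycleSpace G) → ZMod 2 := fun m => if m = x ∨ m = y then 1 else 0
    have hside : ∀ e, g (U e) = g (U e + a e) := by
      intro e
      have hiff : e ∈ bd x ↔ e ∈ bd y := by rw [hxy]
      simp only [bd, Finset.mem_filter, Finset.mem_univ, true_and] at hiff
      by_cases h0 : a e = 0
      · rw [h0, add_zero]
      · have hiff' : (U e = x ∨ U e = y) ↔ (U e + a e = x ∨ U e + a e = y) := by grind
        simp only [g, hiff']
    have hval : ∀ w ∈ X, g w = g 0 := by
      intro w hw
      obtain ⟨e, -, rfl | rfl⟩ := (hX_iff w).1 hw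
      · exact hconn g hside e
      · rw [← hside, hconn g hside e]
    have h1 : g z = g x := (hval z hz).trans (hval x hx).symm
    simp only [Finset.mem_insert, Finset.mem_singleton] at hzxy
    simp [g, hzxy] at h1
  by_cases h3 : 3 ≤ X.card
  · have htri : (X.filter fun x => (bd x).card = 3).card ≤ (G.cliqueFinset 3).card := by
      have hT : ∀ x : {x // x ∈ X.filter fun x => (bd x).card = 3}, ∃ T ∈ G.cliqueFinset 3,
          ∀ e : G.edgeSet, e ∈ bd x ↔ ∀ v ∈ e.1, v ∈ T := by
        rintro ⟨x, hx⟩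
        rw [Finset.mem_filter] at hx
        exact (three_le_card_of_even (hbd_even x) (hbd_ne x hx.1)).2 hx.2
      choose T hT1 hT2 using hT
      rw [← Finset.card_attach]
      refine Finset.card_le_card_of_injOn T (fun x _ => hT1 x) fun x _ y _ hxy => ?_
      have : bd x = bd y := by
        ext e
        rw [hT2, hT2, hxy]
      exact Subtype.ext (hinj h3 (Finset.mem_filter.1 x.2).1 (Finset.mem_filter.1 y.2).1 this)
    have hlow : 4 * X.card ≤ ∑ x ∈ X, (bd x).card + (X.filter fun x => (bd x).card = 3).card := by
      rw [Finset.card_filter (fun x => (bd x).card = 3) X, ← Finset.sum_add_distrib, mul_comm,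
        ← smul_eq_mul, ← Finset.sum_const]
      refine Finset.sum_le_sum fun x hx => ?_
      have := (three_le_card_of_even (hbd_even x) (hbd_ne x hx)).1
      split_ifs <;> omega
    omega
  · omega

/-! ### Weak unit interval graphs -/

theorem centredInterval_inter_nonempty_iff (c d : ℝ) :
    (centredInterval c ∩ centredInterval d).Nonempty ↔ |c - d| ≤ 1 := by
  rw [centredInterval, centredInterval, Set.Icc_inter_Icc, Set.nonempty_Icc, sup_le_iff,
    le_inf_iff, le_inf_iff, abs_le]
  constructor
  · rintro ⟨⟨h1, h2⟩, h3, h4⟩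
    constructor <;> linarith
  · rintro ⟨h1, h2⟩
    refine ⟨⟨?_, ?_⟩, ?_, ?_⟩ <;> linarith

theorem IsWeakUnitIntervalGraph.exists_abs_sub_le_iff {V : Type*} {G : SimpleGraph V}
    (hG : IsWeakUnitIntervalGraph G) (l : Sym2 V → Label) :
    ∃ I : V → ℝ, ∀ u v, G.Adj u v → (|I u - I v| ≤ 1 ↔ l s(u, v) = Label.near) := by
  obtain ⟨I, hI⟩ := hG fun e => l e.1
  exact ⟨I, fun u v h => (centredInterval_inter_nonempty_iff _ _).symm.trans (hI u v h)⟩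

theorem IsWeakUnitIntervalGraph.mono {V : Type*} {G H : SimpleGraph V} (hle : H ≤ G)
    (hG : IsWeakUnitIntervalGraph G) : IsWeakUnitIntervalGraph H := by
  classical
  intro l
  obtain ⟨I, hI⟩ := hG fun e => if h : e.1 ∈ H.edgeSet then l ⟨e.1, h⟩ else Label.near
  refine ⟨I, fun u v h => ?_⟩
  have hl : (if h : s(u, v) ∈ H.edgeSet then l ⟨s(u, v), h⟩ else Label.near) = l ⟨s(u, v), h⟩ :=
    dif_pos h
  exact (hI u v (hle h)).trans (iff_of_eq (congrArg (fun z => z = Label.near) hl))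

theorem IsPlanar.mono {V : Type*} {G H : SimpleGraph V} (hle : H ≤ G) (hG : IsPlanar G) :
    IsPlanar H := by
  obtain ⟨D⟩ := hG
  have hsub := SimpleGraph.edgeSet_mono hle
  exact ⟨{
    pos := D.pos
    arc := D.arc
    pos_injective := D.pos_injective
    isPolygonalArc := fun u v h => D.isPolygonalArc u v (hle h)
    mem_of_pos_mem := fun e he => D.mem_of_pos_mem e (hsub he)
    inter_subset := fun e he f hf => D.inter_subset e (hsub he) f (hsub hf) }⟩

/-- In a weak unit interval graph the neighbors of a vertex `c` induce a forest. Suppose that the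
edge `vw` lies on a cycle among the neighbors of `c`. Label `vw` far, label `cv` and `cw` near, the
other edges at `c` far, and the remaining edges near. The far edge `vw` forces `v` and `w` to
different sides of `c`, but along the rest of the cycle each near edge has an end whose interval
misses that of `c`, so that all its vertices are on the same side. -/
theorem IsWeakUnitIntervalGraph.isAcyclic_induce_neighborSet {V : Type*} {G : SimpleGraph V}
    (hG : IsWeakUnitIntervalGraph G) (c : V) : (G.induce (G.neighborSet c)).IsAcyclic := by
  classical
  rw [SimpleGraph.isAcyclic_iff_forall_adj_isBridge]
  rintro ⟨v, hv⟩ ⟨w, hw⟩ hvw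
  rw [SimpleGraph.isBridge_iff]
  intro hreach
  rw [SimpleGraph.comap_adj] at hvw
  change G.Adj v w at hvw
  rw [SimpleGraph.mem_neighborSet] at hv hw
  obtain ⟨I, hI⟩ := hG.exists_abs_sub_le_iff fun e => if e = s(v, w) then Label.far else
    if c ∈ e then (if v ∈ e ∨ w ∈ e then Label.near else Label.far) else Label.near
  have hcv := hv.ne
  have hcw := hw.ne
  have h1 : |I c - I v| ≤ 1 := by
    rw [hI c v hv, if_neg]
    · simp
    · intro h
      have : c ∈ s(v, w) := h ▸ Sym2.mem_mk_left c v
      rcases Sym2.mem_iff.1 this with h | h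
      · exact hcv h
      · exact hcw h
  have h2 : |I c - I w| ≤ 1 := by
    rw [hI c w hw, if_neg]
    · simp
    · intro h
      have : c ∈ s(v, w) := h ▸ Sym2.mem_mk_left c w
      rcases Sym2.mem_iff.1 this with h | h
      · exact hcv h
      · exact hcw h
  have h3 : ¬ |I v - I w| ≤ 1 := by
    rw [hI v w hvw, if_pos rfl]
    simp
  have hfar : ∀ x, G.Adj c x → x ≠ v → x ≠ w → ¬ |I c - I x| ≤ 1 := by
    intro x hx hxv hxw
    rw [hI c x hx, if_neg, if_pos (Sym2.mem_mk_left c x), if_neg]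
    · simp
    · rw [Sym2.mem_iff, Sym2.mem_iff]
      rintro ((h | h) | (h | h))
      exacts [hcv h.symm, hxv h.symm, hcw h.symm, hxw h.symm]
    · intro h
      have : c ∈ s(v, w) := h ▸ Sym2.mem_mk_left c x
      rcases Sym2.mem_iff.1 this with h | h
      · exact hcv h
      · exact hcw h
  have hside : ∀ x y, G.Adj c x → G.Adj c y → G.Adj x y → s(x, y) ≠ s(v, w) →
      (I c < I x ↔ I c < I y) := by
    intro x y hx hy hxy hne
    have hnear : |I x - I y| ≤ 1 := by
      rw [hI x y hxy, if_neg hne, if_neg]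
      rw [Sym2.mem_iff]
      rintro (h | h)
      · exact hx.ne h
      · exact hy.ne h
    have hor : ¬ |I c - I x| ≤ 1 ∨ ¬ |I c - I y| ≤ 1 := by
      by_contra! hcon
      have hx' : x = v ∨ x = w := by
        by_contra! h
        exact hfar x hx h.1 h.2 hcon.1
      have hy' : y = v ∨ y = w := by
        by_contra! h
        exact hfar y hy h.1 h.2 hcon.2
      have hxy' := hxy.ne
      rcases hx' with rfl | rfl <;> rcases hy' with rfl | rfl
      · exact hxy' rfl
      · exact hne rfl
      · exact hne Sym2.eq_swap
      · exact hxy' rfl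
    rw [abs_le] at hnear
    rw [abs_le, abs_le] at hor
    constructor
    · intro h
      by_contra h'
      rcases hor with h4 | h4 <;> exact h4 ⟨by linarith, by linarith⟩
    · intro h
      by_contra h'
      rcases hor with h4 | h4 <;> exact h4 ⟨by linarith, by linarith⟩
  have hiff : I c < I v ↔ I c < I w := by
    obtain ⟨p⟩ := hreach
    have hwalk : ∀ (x y : G.neighborSet c) (_ : ((G.induce (G.neighborSet c)).deleteEdges
        {s(⟨v, hv⟩, ⟨w, hw⟩)}).Walk x y), (I c < I x ↔ I c < I y) := by
      intro x y p
      induction p with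
      | nil => rfl
      | @cons x y z hadj _ ih =>
        rw [← ih]
        rw [SimpleGraph.deleteEdges_adj] at hadj
        refine hside x y x.2 y.2 hadj.1 fun h => hadj.2 ?_
        rw [Set.mem_singleton_iff]
        rw [Sym2.eq_iff] at h ⊢
        simpa only [Subtype.ext_iff] using h
    exact hwalk _ _ p
  rw [abs_le] at h1 h2 h3
  by_cases h : I c < I v
  · have h' := hiff.1 h
    exact h3 ⟨by linarith, by linarith⟩
  · have h' : ¬ I c < I w := fun h' => h (hiff.2 h')
    rw [not_lt] at h h'
    exact h3 ⟨by linarith, by linarith⟩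

/-- A nonempty forest has fewer edges than vertices, as it extends to a tree. -/
theorem _root_.SimpleGraph.IsAcyclic.card_edgeSet_lt {W : Type*} [Fintype W] [Nonempty W]
    {F : SimpleGraph W} (hF : F.IsAcyclic) : Nat.card F.edgeSet < Fintype.card W := by
  classical
  obtain ⟨T, hFT, -, hT⟩ :=
    SimpleGraph.Connected.exists_isTree_le_of_le_of_isAcyclic SimpleGraph.connected_top le_top hF
  rw [← hT.card_edgeFinset, Nat.card_eq_fintype_card, ← SimpleGraph.edgeFinset_card]
  exact Nat.lt_succ_of_le (Finset.card_le_card (SimpleGraph.edgeFinset_mono hFT))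

open Classical in
/-- The triangles at `v` correspond to the edges of the forest induced by its neighbors. -/
theorem IsWeakUnitIntervalGraph.card_triangles_lt_degree {V : Type*} [Fintype V]
    {G : SimpleGraph V} (hG : IsWeakUnitIntervalGraph G) {v : V} (hv : 0 < G.degree v) :
    ((G.cliqueFinset 3).filter fun T => v ∈ T).card < G.degree v := by
  have hne : Nonempty (G.neighborSet v) := by
    rw [← SimpleGraph.card_neighborSet_eq_degree] at hv
    exact Fintype.card_pos_iff.1 hv
  have h := (hG.isAcyclic_induce_neighborSet v).card_edgeSet_lt
  rw [SimpleGraph.card_neighborSet_eq_degree, Nat.card_eq_fintype_card] at h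
  refine lt_of_le_of_lt ?_ h
  rw [← Finset.card_univ]
  -- A triangle at `v` arises from the edge joining its two other vertices.
  refine (Finset.card_le_card (t := Finset.univ.image
    fun e : (G.induce (G.neighborSet v)).edgeSet => insert v (e.1.map Subtype.val).toFinset)
    fun T hT => ?_).trans Finset.card_image_le
  obtain ⟨hT, hvT⟩ := Finset.mem_filter.1 hT
  rw [SimpleGraph.mem_cliqueFinset_iff] at hT
  obtain ⟨a, b, hab, hTv⟩ := Finset.card_eq_two.1
    (show (T.erase v).card = 2 by rw [Finset.card_erase_of_mem hvT, hT.card_eq])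
  have ha : a ∈ T.erase v := by simp [hTv]
  have hb : b ∈ T.erase v := by simp [hTv]
  rw [Finset.mem_erase] at ha hb
  have hva : G.Adj v a := hT.isClique hvT ha.2 ha.1.symm
  have hvb : G.Adj v b := hT.isClique hvT hb.2 hb.1.symm
  have hab' : G.Adj a b := hT.isClique ha.2 hb.2 hab
  refine Finset.mem_image.2 ⟨⟨s(⟨a, hva⟩, ⟨b, hvb⟩), hab'⟩, Finset.mem_univ _, ?_⟩
  rw [← Finset.insert_erase hvT, hTv]
  ext x
  simp [Sym2.mem_toFinset]

open Classical in
theorem sum_degree_eq_two_mul {V : Type*} [Fintype V] {G : SimpleGraph V} {A : Finset V}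
    (hA : ∀ v w, G.Adj v w → v ∈ A) : ∑ v ∈ A, G.degree v = 2 * Fintype.card G.edgeSet := by
  rw [← SimpleGraph.edgeFinset_card, ← G.sum_degrees_eq_twice_card_edges]
  refine Finset.sum_subset (Finset.subset_univ A) fun v _ hv => ?_
  by_contra h
  obtain ⟨w, hw⟩ := (G.degree_pos_iff_exists_adj v).1 (Nat.pos_of_ne_zero h)
  exact hv (hA v w hw)

open Classical in
theorem sum_degree_le {V : Type*} [Fintype V] {G : SimpleGraph V} {A : Finset V}
    (hA : ∀ v w, G.Adj v w → v ∈ A) : ∑ v ∈ A, G.degree v ≤ A.card * (A.card - 1) := by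
  rw [← smul_eq_mul]
  refine Finset.sum_le_card_nsmul _ _ _ fun v hv => ?_
  rw [← Finset.card_erase_of_mem hv, ← SimpleGraph.card_neighborFinset_eq_degree]
  refine Finset.card_le_card fun w hw => ?_
  rw [SimpleGraph.mem_neighborFinset] at hw
  exact Finset.mem_erase.2 ⟨hw.ne', hA w v hw.symm⟩

open Classical in
/-- The edge bound for planar weak unit interval graphs; `A` is any set of at least four vertices
that contains all nonisolated ones. -/
theorem IsWeakUnitIntervalGraph.four_mul_card_edgeSet_add_le {V : Type*} [Fintype V]
    {G : SimpleGraph V} (hG : IsWeakUnitIntervalGraph G) (hplanar : IsPlanar G) {A : Finset V}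
    (hA : ∀ v w, G.Adj v w → v ∈ A) (h4 : 4 ≤ A.card) :
    4 * Fintype.card G.edgeSet + 24 ≤ 11 * A.card := by
  let B : Finset V := Finset.univ.filter fun v => 0 < G.degree v
  have hB : ∀ v w, G.Adj v w → v ∈ B := fun v w h => Finset.mem_filter.2
    ⟨Finset.mem_univ v, (G.degree_pos_iff_exists_adj v).2 ⟨w, h⟩⟩
  have hBA : B ⊆ A := by
    intro v hv
    obtain ⟨w, hw⟩ := (G.degree_pos_iff_exists_adj v).1 (Finset.mem_filter.1 hv).2
    exact hA v w hw
  have hcard := Finset.card_le_card hBA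
  have hdeg := sum_degree_eq_two_mul hB
  -- Isolated vertices are left out, since they would spoil the count of triangles by degrees.
  by_cases hB4 : 4 ≤ B.card
  · have h1 := hplanar.two_mul_card_edgeSet_add_le hB hB4
    have h2 : ∑ v ∈ B, (((G.cliqueFinset 3).filter fun T => v ∈ T).card + 1) ≤
        ∑ v ∈ B, G.degree v := Finset.sum_le_sum fun v hv =>
      hG.card_triangles_lt_degree (Finset.mem_filter.1 hv).2
    have h3 : ∑ v ∈ B, ((G.cliqueFinset 3).filter fun T => v ∈ T).card =
        3 * (G.cliqueFinset 3).card := by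
      simp only [Finset.card_filter]
      rw [Finset.sum_comm, mul_comm, ← smul_eq_mul, ← Finset.sum_const]
      refine Finset.sum_congr rfl fun T hT => ?_
      rw [SimpleGraph.mem_cliqueFinset_iff] at hT
      rw [← Finset.card_filter, ← hT.card_eq]
      congr 1
      ext v
      rw [Finset.mem_filter]
      refine ⟨fun h => h.2, fun h => ⟨?_, h⟩⟩
      obtain ⟨w, hw, hwv⟩ := Finset.exists_mem_ne (by rw [hT.card_eq]; norm_num) v
      exact hB v w (hT.isClique h hw hwv.symm)
    rw [Finset.sum_add_distrib, h3, Finset.sum_const, smul_eq_mul, mul_one] at h2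
    omega
  · have h1 := sum_degree_le hB
    have h2 : B.card * (B.card - 1) ≤ 3 * 2 := Nat.mul_le_mul (by omega) (by omega)
    omega

theorem IsWeakUnitIntervalGraph.averageDegree_lt {V : Type*} [Fintype V] {G : SimpleGraph V}
    (hG : IsWeakUnitIntervalGraph G) (hplanar : IsPlanar G) (H : G.Subgraph)
    (hne : H.verts.Nonempty) : averageDegree H < 11 / 2 := by
  classical
  have hle : H.spanningCoe ≤ G := H.spanningCoe_le
  let A : Finset V := Finset.univ.filter fun v => v ∈ H.verts
  have hA : ∀ v w, H.spanningCoe.Adj v w → v ∈ A := fun v w h =>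
    Finset.mem_filter.2 ⟨Finset.mem_univ v, H.edge_vert h⟩
  have hcard : H.verts.ncard = A.card := by
    rw [← Set.ncard_coe_finset]
    simp [A]
  have hpos : 0 < A.card := by
    obtain ⟨v, hv⟩ := hne
    exact Finset.card_pos.2 ⟨v, by simpa [A] using hv⟩
  have hsum : averageDegree H = ((∑ v ∈ A, H.spanningCoe.degree v : ℕ) : ℝ) / (A.card : ℝ) := by
    rw [averageDegree, hcard, Nat.cast_sum]
    congr 1
    refine Finset.sum_congr (by simp [A]) fun v _ => ?_
    rw [← SimpleGraph.Subgraph.degree_spanningCoe]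
  rw [hsum, div_lt_div_iff₀ (by exact_mod_cast hpos) (by norm_num)]
  norm_cast
  by_cases h4 : 4 ≤ A.card
  · have h1 := (hG.mono hle).four_mul_card_edgeSet_add_le (hplanar.mono hle) hA h4
    have h2 := sum_degree_eq_two_mul hA
    omega
  · have h1 := sum_degree_le hA
    have h2 : A.card * (A.card - 1) ≤ A.card * 2 := Nat.mul_le_mul le_rfl (by omega)
    omega

end WeakUnitInterval

theorem mainTheorem5 {V : Type*} [Fintype V] (G : SimpleGraph V)
    (hG : WeakUnitInterval.IsPlanar G) :
    ((11 : ℝ) / 2 ≤ WeakUnitInterval.mad G → ¬ WeakUnitInterval.IsWeakUnitIntervalGraph G) ∧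
    (WeakUnitInterval.IsWeakUnitIntervalGraph G → 4 ≤ Fintype.card V →
      (G.edgeSet.ncard : ℝ) ≤ 11 * (Fintype.card V : ℝ) / 4 - 6) := by
  classical
  refine ⟨fun hmad hW => ?_, fun hW h4 => ?_⟩
  · have hfin : {d : ℝ | ∃ H : G.Subgraph, H.verts.Nonempty ∧
        WeakUnitInterval.averageDegree H = d}.Finite := by
      refine (Set.finite_range fun H : G.Subgraph => WeakUnitInterval.averageDegree H).subset ?_
      rintro d ⟨H, -, rfl⟩
      exact ⟨H, rfl⟩
    rcases Set.eq_empty_or_nonempty {d : ℝ | ∃ H : G.Subgraph, H.verts.Nonempty ∧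
        WeakUnitInterval.averageDegree H = d} with hE | hE
    · rw [WeakUnitInterval.mad, hE, Real.sSup_empty] at hmad
      norm_num at hmad
    · obtain ⟨H, hH, hd⟩ := hE.csSup_mem hfin
      have hlt := hW.averageDegree_lt hG H hH
      rw [hd] at hlt
      exact absurd hmad (not_le.2 hlt)
  · have h := hW.four_mul_card_edgeSet_add_le hG (A := Finset.univ)
      (fun v _ _ => Finset.mem_univ v) (by rwa [Finset.card_univ])
    rw [Finset.card_univ, ← Nat.card_eq_fintype_card, Nat.card_coe_set_eq] at h
    have h' : (4 * G.edgeSet.ncard + 24 : ℝ) ≤ 11 * Fintype.card V := by exact_mod_cast h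
    linarith
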